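/- Let $n\ge 1$ and let $K\subset\mathbb{R}^n$ be a convex body, i.e. a compact convex set with nonempty interior. Write $w(K)=2\int_{\mathbb{S}^{n-1}}h_K\,d\sigma$ for its mean width, where $h_K(u)=\sup_{x\in K}\langle x,u\rangle$ and $\sigma$ is the normalized surface measure on the sphere, let $B_n$ be the Euclidean unit ball, and let $K_w^*=\frac{w(K)}{w(B_n)}B_n$ be the ball centred at the origin with the same mean width as $K$. Let $I_K^\infty$ be $0$ on $K$ and $+\infty$ elsewhere, and let $\mathbb{1}_K$ be $1$ on $K$ and $0$ elsewhere. For a unit vector $u$ let $R_u(x)=x-2\langle x,u\rangle u$; the Minkowski symmetral of $\psi:\mathbb{R}^n\to(-\infty,+\infty]$ is $$\tau_u\psi(x)=\inf_{y+z=x}\left\{\tfrac12\psi(2y)+\tfrac12\psi(R_u(2z))\right\}.$$ An epi-symmetrization $\psi_{\rm sym}$ of $\psi$ is a rotation-invariant (i.e. invariant under all orthogonal transformations), convex, coercive, proper, lower semicontinuous function to which some subsequence of the successive symmetrals $\tau_{u_m}\cdots\tau_{u_1}\psi$, for some sequence $(u_i)$ of unit vectors, epi-converges. For $\alpha\in\mathbb{R}$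 and $f\ge 0$ let $\mathrm{base}_\alpha f=\frac{1-f^\alpha}{\alpha}$ if $\alpha\ne0$, $\mathrm{base}_0 f=-\log f$ (with value $+\infty$ where $f=0$); a hypo-symmetrization of $f$ is $f_{\rm sym}=(1-\alpha\psi_{\rm sym})_+^{1/\alpha}$ (for $\alpha=0$: $f_{\rm sym}=e^{-\psi_{\rm sym}}$), where $\psi_{\rm sym}$ is an epi-symmetrization of $\psi=\mathrm{base}_\alpha f$. Then $(I_K^\infty)_{\rm sym}=I_{K_w^*}^\infty$; that is, $I_{K_w^*}^\infty$ is an epi-symmetrization of $I_K^\infty$ and the only one, and there is a sequence $(u_i)$ of unit vectors for which the full sequence $\tau_{u_m}\cdots\tau_{u_1}I_K^\infty$ epi-converges to $I_{K_w^*}^\infty$. Equivalently, for every $\alpha\in\mathbb{R}$, $(\mathbb{1}_K)_{\rm sym}=\mathbb{1}_{K_w^*}$; that is, $\mathbb{1}_{K_w^*}$ is a hypo-symmetrization of $\mathbb{1}_K$ and the only one. -/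

import Mathlib

open Filter Topology MeasureTheory Metric

noncomputable section

namespace HypoSym

/-- Euclidean space `ℝⁿ`. -/
abbrev E (n : ℕ) := EuclideanSpace ℝ (Fin n)

variable {n : ℕ}

/-! ### Convex bodies and mean width -/

/-- A convex body: a compact convex set with nonempty interior. -/
structure IsConvexBody (K : Set (E n)) : Prop where
  convex : Convex ℝ K
  compact : IsCompact K
  interior_nonempty : (interior K).Nonempty

/-- The support function `h_K(u) = sup_{x ∈ K} ⟨x, u⟩` (meaningful for nonempty bounded `K`). -/
def supportFn (K : Set (E n)) (u : E n) : ℝ :=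
  sSup ((fun x : E n => inner ℝ x u) '' K)

/-- The mean width `w(K) = 2 ∫_{S^{n-1}} h_K dσ`, where `σ` is the normalized surface measure on
the unit sphere; the average integral `⨍` against the surface measure `volume.toSphere` performs
the normalization. -/
def meanWidth (K : Set (E n)) : ℝ :=
  2 * ⨍ u : sphere (0 : E n) 1, supportFn K (u : E n) ∂((volume : Measure (E n)).toSphere)

/-- The Euclidean ball `K_w^* = (w(K) / w(B_n)) B_n` centred at the origin. -/
def meanWidthBall (K : Set (E n)) : Set (E n) :=
  {y | ∃ x ∈ closedBall (0 : E n) 1,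
    y = (meanWidth K / meanWidth (closedBall (0 : E n) 1)) • x}

open scoped Classical in
/-- The convex indicator `I_K^∞`: `0` on `K` and `+∞` off `K`. -/
def convexIndicator (K : Set (E n)) (x : E n) : EReal := if x ∈ K then 0 else ⊤

/-- The characteristic function `1_K`: `1` on `K` and `0` off `K`. -/
def charFn (K : Set (E n)) : E n → ℝ := Set.indicator K (fun _ => 1)

/-! ### Coercive convex functions, epi-convergence -/

/-- The class `Conv_c(ℝⁿ)` of convex, coercive, proper, lower semicontinuous functions.
Convexity of an extended-real function means convexity of its epigraph. -/
structure IsConvC (ψ : E n → EReal) : Prop where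
  convex : Convex ℝ {p : E n × ℝ | ψ p.1 ≤ (p.2 : EReal)}
  coercive : Tendsto ψ (Bornology.cobounded (E n)) (𝓝 ⊤)
  dom_nonempty : ∃ x, ψ x < ⊤
  ne_bot : ∀ x, ψ x ≠ ⊥
  lsc : LowerSemicontinuous ψ

/-- Invariance under all orthogonal transformations, i.e. dependence on `‖x‖` only. -/
def RotationInvariant (φ : E n → EReal) : Prop :=
  ∀ (θ : E n ≃ₗᵢ[ℝ] E n) (x : E n), φ (θ x) = φ x

/-- Epi-convergence of `ψ_j` to `ψ`, in sequential form. -/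
def EpiConverges (Ψ : ℕ → E n → EReal) (ψ : E n → EReal) : Prop :=
  ∀ x : E n,
    (∀ xs : ℕ → E n, Tendsto xs atTop (𝓝 x) →
      ψ x ≤ liminf (fun j => Ψ j (xs j)) atTop) ∧
    (∃ xs : ℕ → E n, Tendsto xs atTop (𝓝 x) ∧
      Tendsto (fun j => Ψ j (xs j)) atTop (𝓝 (ψ x)))

/-! ### Minkowski symmetrization of convex functions -/

/-- The infimal convolution `(φ □ ψ)(x) = inf_{y + z = x} (φ(y) + ψ(z))`. -/
def infConv (φ ψ : E n → EReal) (x : E n) : EReal := ⨅ y : E n, φ y + ψ (x - y)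

/-- The epi-multiplication `x ↦ c ψ(x / c)` for `c > 0`. -/
def epiMul (c : ℝ) (ψ : E n → EReal) (x : E n) : EReal := (c : EReal) * ψ (c⁻¹ • x)

/-- The reflection `R_u(x) = x - 2⟨x, u⟩u` about the hyperplane `u^⊥`, for a unit vector `u`. -/
def reflect (u : sphere (0 : E n) 1) (x : E n) : E n :=
  x - (2 * inner ℝ x (u : E n)) • (u : E n)

/-- The Minkowski symmetral of `ψ` about `u^⊥`: the infimal convolution of the epi-multiples by
`1/2` of `ψ` and of its reflection `R_u ψ = ψ ∘ R_u`. -/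
def minkSym (u : sphere (0 : E n) 1) (ψ : E n → EReal) : E n → EReal :=
  infConv (epiMul (1 / 2) ψ) (epiMul (1 / 2) (fun x => ψ (reflect u x)))

/-- Successive Minkowski symmetrizations: `minkSymIter u ψ m = τ_{u_{m-1}} ∘ ⋯ ∘ τ_{u_0} ψ`. -/
def minkSymIter (u : ℕ → sphere (0 : E n) 1) (ψ : E n → EReal) : ℕ → E n → EReal
  | 0 => ψ
  | m + 1 => minkSym (u m) (minkSymIter u ψ m)

/-- `φ` is an epi-symmetrization `ψ_sym` of `ψ`: a rotation-invariant function of class `Conv_c`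
which is the epi-limit of a sequence of Minkowski symmetrizations of `ψ`. Passing to a subsequence
of the successive symmetrals is allowed; `k = id` is the whole sequence. -/
def IsEpiSymmetrization (ψ φ : E n → EReal) : Prop :=
  IsConvC φ ∧ RotationInvariant φ ∧
    ∃ (u : ℕ → sphere (0 : E n) 1) (k : ℕ → ℕ), StrictMono k ∧
      EpiConverges (fun j => minkSymIter u ψ (k j)) φ

/-! ### Base functions and hypo-symmetrization -/

/-- The base function `base_α f = (1 - f^α)/α` of a nonnegative function `f`, with
`base_0 f = -log f`. It is `+∞` off the support of `f`, for every `α` (for `α ≤ 0` this is the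
value of the formula, for `α > 0` it is what makes the base function convex). -/
def base (α : ℝ) (f : E n → ℝ) (x : E n) : EReal :=
  if f x = 0 then ⊤
  else if α = 0 then ((-Real.log (f x) : ℝ) : EReal)
  else (((1 - f x ^ α) / α : ℝ) : EReal)

/-- The function `(1 - αφ)_+^{1/α}` (`e^{-φ}` for `α = 0`), with value `0` where `φ = +∞`;
for `φ` with values in `(-∞, +∞]`. -/
def ofBase (α : ℝ) (φ : E n → EReal) (x : E n) : ℝ :=
  if φ x = ⊤ then 0
  else if α = 0 then Real.exp (-(φ x).toReal)
  else (max (1 - α * (φ x).toReal) 0) ^ (1 / α)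

/-- `g` is a hypo-symmetrization `f_sym` of `f` (as an `α`-concave function):
`g = (1 - αψ_sym)_+^{1/α}`, where `ψ` is the base function of `f`. -/
def IsHypoSymmetrization (α : ℝ) (f g : E n → ℝ) : Prop :=
  ∃ φ : E n → EReal, IsEpiSymmetrization (base α f) φ ∧ g = ofBase α φ

end HypoSym

end

/-!
The Minkowski symmetral of the indicator of `K` is the indicator of `(K + R_u K) / 2`, so on
support functions symmetrization replaces `h` by the average of `h` and `h ∘ R_u`. Such averages
cannot raise the maximum of `h` over the sphere, and as long as `h` is not nearly constant a
Harnack type inequality makes the maximum drop by a definite amount over each window of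
directions long enough for the reflections in it to move any point of the sphere near any other.
Choosing `u` so that such windows have a uniform length, the support functions converge uniformly
to a constant, i.e. the symmetrals converge to a centred ball. Reflection invariance of the
surface measure shows that the mean width is unchanged by symmetrization, which identifies the
radius.

For uniqueness, an epi-limit of indicators is an indicator, and a compact convex set invariant under
all isometries is a centred ball; epi-convergence of bounded sets makes the support functions
converge pointwise, so the mean width passes to the limit and again determines the radius.
-/

noncomputable section

namespace HypoSym

open scoped NNReal Pointwise

section Averaging

variable {X : Type*} {T : ℕ → X → X} {h : ℕ → X → ℝ}

/-- The functions `h m` evolve by `h (m + 1) = (h m + h m ∘ T m) / 2`. This is how the support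
functions of successive Minkowski symmetrals evolve, with `T m` the `m`-th reflection. -/
def IsAveraging (T : ℕ → X → X) (h : ℕ → X → ℝ) : Prop :=
  ∀ m x, h (m + 1) x = (h m x + h m (T m x)) / 2

/-- For every `δ > 0` there is a window length `W` such that among any `W` consecutive maps `T m`
there is one moving `x` into the `δ`-ball around `y`, unless `x` already lies in that ball. -/
def IsUniformlyTransitive [PseudoMetricSpace X] (T : ℕ → X → X) : Prop :=
  ∀ δ > 0, ∃ W : ℕ, ∀ m x y, dist x y < δ ∨ ∃ j < W, dist (T (m + j) x) y < δ

namespace IsAveraging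

theorem const_sub (H : IsAveraging T h) (b : ℝ) : IsAveraging T fun m x => b - h m x := by
  intro m x
  simp only [H m x]
  ring

theorem le_of_le (H : IsAveraging T h) {m k : ℕ} (hmk : m ≤ k) {b : ℝ} (hb : ∀ x, b ≤ h m x)
    (x : X) : b ≤ h k x := by
  induction k, hmk using Nat.le_induction generalizing x with
  | base => exact hb x
  | succ k _ ih => rw [H]; linarith [ih x, ih (T k x)]

theorem ge_of_ge (H : IsAveraging T h) {m k : ℕ} (hmk : m ≤ k) {b : ℝ} (hb : ∀ x, h m x ≤ b)
    (x : X) : h k x ≤ b :=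
  sub_nonneg.1 <| (H.const_sub b).le_of_le hmk (fun x => sub_nonneg.2 (hb x)) x

theorem le_two_pow_mul (H : IsAveraging T h) {m : ℕ} (h0 : ∀ x, 0 ≤ h m x) (k : ℕ) (x : X) :
    h m x ≤ 2 ^ k * h (m + k) x := by
  induction k with
  | zero => simp
  | succ k ih =>
    have hstep : h (m + k) x ≤ 2 * h (m + (k + 1)) x := by
      rw [← add_assoc, H]; linarith [H.le_of_le (m.le_add_right k) h0 (T (m + k) x)]
    calc h m x ≤ 2 ^ k * h (m + k) x := ih
      _ ≤ 2 ^ k * (2 * h (m + (k + 1)) x) := by gcongr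
      _ = 2 ^ (k + 1) * h (m + (k + 1)) x := by ring

/-- A Harnack inequality: a lower bound on a set that every orbit visits becomes, up to a factor,
a lower bound everywhere. -/
theorem le_two_pow_mul_of_visits (H : IsAveraging T h) {m W : ℕ}
    (h0 : ∀ x, 0 ≤ h m x) {S : Set X} (hW : ∀ x, x ∈ S ∨ ∃ j < W, T (m + j) x ∈ S) {ε : ℝ}
    (hS : ∀ x ∈ S, ε ≤ h m x) (x : X) : ε ≤ 2 ^ W * h (m + W) x := by
  rcases hW x with hx | ⟨j, hj, hx⟩
  · exact (hS x hx).trans (H.le_two_pow_mul h0 W x)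
  obtain ⟨i, rfl⟩ := Nat.exists_eq_add_of_lt hj
  have hstep : h (m + j) (T (m + j) x) ≤ 2 * h (m + j + 1) x := by
    rw [H]; linarith [H.le_of_le (m.le_add_right j) h0 x]
  calc ε ≤ h m (T (m + j) x) := hS _ hx
    _ ≤ 2 ^ j * h (m + j) (T (m + j) x) := H.le_two_pow_mul h0 j _
    _ ≤ 2 ^ j * (2 * h (m + j + 1) x) := by gcongr
    _ ≤ 2 ^ j * (2 * (2 ^ i * h (m + j + 1 + i) x)) := by
      gcongr; exact H.le_two_pow_mul (H.le_of_le (by lia) h0) i x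
    _ = 2 ^ (j + i + 1) * h (m + (j + i + 1)) x := by
      rw [show m + j + 1 + i = m + (j + i + 1) by ring]; ring

variable [PseudoMetricSpace X]

theorem exists_forall_sub_le (H : IsAveraging T h) (hT : IsUniformlyTransitive T)
    (hequi : UniformEquicontinuous h) {R : ℝ} (hR : ∀ x, |h 0 x| ≤ R) {ε : ℝ} (hε : 0 < ε) :
    ∃ m, ∀ x y, h m x - h m y ≤ ε := by
  by_contra! hosc
  obtain ⟨δ, hδ, hhδ⟩ := Metric.uniformEquicontinuous_iff.1 hequi (ε / 2) (half_pos hε)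
  obtain ⟨W, hW⟩ := hT δ hδ
  set c := ε / 2 / 2 ^ W
  have hc0 : 0 < c := by positivity
  have hdrop : ∀ m b, (∀ x, h m x ≤ b) → ∀ x, h (m + W) x ≤ b - c := by
    intro m b hb x
    obtain ⟨y, z, hyz⟩ := hosc m
    have hball : ∀ x ∈ ball z δ, ε / 2 ≤ b - h m x := fun x hx => by
      linarith [(abs_lt.1 (hhδ x z hx m)).2, hb y]
    have hharnack := (H.const_sub b).le_two_pow_mul_of_visits (fun x => sub_nonneg.2 (hb x))
      (fun x => hW m x z) hball x
    have hcx : c ≤ b - h (m + W) x := (div_le_iff₀' (by positivity)).2 hharnack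
    linarith
  have hiter : ∀ j : ℕ, ∀ x, h (j * W) x ≤ R - j * c := by
    intro j
    induction j with
    | zero => simpa using fun x => (abs_le.1 (hR x)).2
    | succ j ih =>
      intro x
      rw [add_mul, one_mul]
      push_cast
      linarith [hdrop _ _ ih x]
  obtain ⟨x, -⟩ := hosc 0
  obtain ⟨j, hj⟩ := exists_nat_gt (2 * R / c)
  rw [div_lt_iff₀ hc0] at hj
  linarith [hiter j x, H.le_of_le (j * W).zero_le (fun x => (abs_le.1 (hR x)).1) x]

theorem exists_tendstoUniformly_const [Nonempty X] (H : IsAveraging T h)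
    (hT : IsUniformlyTransitive T) (hequi : UniformEquicontinuous h) {R : ℝ}
    (hR : ∀ x, |h 0 x| ≤ R) : ∃ r, TendstoUniformly h (fun _ => r) atTop := by
  have hclose : ∀ ε > 0, ∃ m, ∀ k ≥ m, ∀ x y, dist (h k x) (h m y) ≤ ε := by
    intro ε hε
    obtain ⟨m, hm⟩ := H.exists_forall_sub_le hT hequi hR hε
    refine ⟨m, fun k hk x y => abs_sub_le_iff.2 ⟨?_, ?_⟩⟩
    · linarith [H.ge_of_ge hk (b := h m y + ε) (fun x => by linarith [hm x y]) x]
    · linarith [H.le_of_le hk (b := h m y - ε) (fun x => by linarith [hm y x]) x]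
  obtain ⟨y⟩ := ‹Nonempty X›
  have hcauchy : CauchySeq fun m => h m y := by
    refine Metric.cauchySeq_iff'.2 fun ε hε => ?_
    obtain ⟨m, hm⟩ := hclose (ε / 2) (half_pos hε)
    exact ⟨m, fun k hk => (hm k hk y y).trans_lt (half_lt_self hε)⟩
  obtain ⟨r, hr⟩ := cauchySeq_tendsto_of_complete hcauchy
  refine ⟨r, Metric.tendstoUniformly_iff.2 fun ε hε => ?_⟩
  obtain ⟨m, hm⟩ := hclose (ε / 3) (by positivity)
  have hrm : dist r (h m y) ≤ ε / 3 :=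
    le_of_tendsto (hr.dist tendsto_const_nhds) <|
      (eventually_ge_atTop m).mono fun k hk => hm k hk y y
  filter_upwards [eventually_ge_atTop m] with k hk x
  linarith [dist_triangle_right r (h k x) (h m y), hm k hk x y]

end IsAveraging

end Averaging

section Recurrence

variable {X : Type*} [TopologicalSpace X]

/-- The sequence visits every nonempty open set within bounded gaps, i.e. the set of visiting times
is syndetic. -/
def IsSyndeticallyDense (u : ℕ → X) : Prop :=
  ∀ U : Set X, IsOpen U → U.Nonempty → ∃ N : ℕ, ∀ m, ∃ j < N, u (m + j) ∈ U

theorem padicValNat_two_eq_of_mod_eq {i m : ℕ} (h : m % 2 ^ (i + 1) = 2 ^ i) :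
    padicValNat 2 m = i := by
  have hm : m = 2 ^ i * (2 * (m / 2 ^ (i + 1)) + 1) := by
    rw [mul_add, ← mul_assoc, ← pow_succ, mul_one]
    exact (h ▸ Nat.div_add_mod m (2 ^ (i + 1))).symm
  rw [hm, padicValNat.mul (by positivity) (by lia), padicValNat.prime_pow,
    padicValNat.eq_zero_of_not_dvd (by lia), add_zero]

theorem exists_lt_add_mod_eq {q r : ℕ} (hr : r < q) (m : ℕ) : ∃ j < q, (m + j) % q = r := by
  refine ⟨(r + (q - m % q)) % q, Nat.mod_lt _ (by lia), ?_⟩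
  have hm := Nat.mod_lt m (by lia : q > 0)
  rw [Nat.add_mod_mod, ← Nat.mod_add_mod,
    show m % q + (r + (q - m % q)) = r + q by lia, Nat.add_mod_right, Nat.mod_eq_of_lt hr]

theorem exists_isSyndeticallyDense [TopologicalSpace.SeparableSpace X] [Nonempty X] :
    ∃ u : ℕ → X, IsSyndeticallyDense u := by
  -- the `i`-th point of a dense sequence is revisited with period `2 ^ (i + 1)`
  refine ⟨fun m => TopologicalSpace.denseSeq X (padicValNat 2 (m + 1)), fun U hU hne => ?_⟩
  obtain ⟨i, hi⟩ := (TopologicalSpace.denseRange_denseSeq X).exists_mem_open hU hne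
  refine ⟨2 ^ (i + 1), fun m => ?_⟩
  obtain ⟨j, hj, hmod⟩ := exists_lt_add_mod_eq (Nat.pow_lt_pow_right one_lt_two i.lt_succ_self)
    (m + 1)
  refine ⟨j, hj, ?_⟩
  change TopologicalSpace.denseSeq X (padicValNat 2 (m + j + 1)) ∈ U
  rwa [add_right_comm, padicValNat_two_eq_of_mod_eq hmod]

theorem IsSyndeticallyDense.exists_window {Y : Type*} [TopologicalSpace Y] {u : ℕ → X}
    (hu : IsSyndeticallyDense u) {O : Set (X × Y)} (hO : IsOpen O) {K : Set Y} (hK : IsCompact K)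
    (hKO : ∀ y ∈ K, ∃ x, (x, y) ∈ O) :
    ∃ N : ℕ, ∀ m, ∀ y ∈ K, ∃ j < N, (u (m + j), y) ∈ O := by
  refine hK.induction_on ⟨0, by simp⟩ ?_ ?_ ?_
  · rintro s t hst ⟨N, hN⟩
    exact ⟨N, fun m y hy => hN m y (hst hy)⟩
  · rintro s t ⟨N, hN⟩ ⟨N', hN'⟩
    refine ⟨max N N', fun m y hy => ?_⟩
    rcases hy with hy | hy
    · exact (hN m y hy).imp fun j hj => hj.imp_left (lt_max_of_lt_left ·)
    · exact (hN' m y hy).imp fun j hj => hj.imp_left (lt_max_of_lt_right ·)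
  · intro y hy
    obtain ⟨x, hx⟩ := hKO y hy
    obtain ⟨U, V, hU, hV, hxU, hyV, hUV⟩ := isOpen_prod_iff.1 hO x y hx
    obtain ⟨N, hN⟩ := hu U hU ⟨x, hxU⟩
    exact ⟨V, mem_nhdsWithin_of_mem_nhds (hV.mem_nhds hyV), N, fun m z hz =>
      (hN m).imp fun j hj => hj.imp_right fun hjU => hUV ⟨hjU, hz⟩⟩

end Recurrence

section UnitSphere

variable {F : Type*} [NormedAddCommGroup F] [NormedSpace ℝ F]

/-- The action of a linear isometric equivalence on the unit sphere. -/
def sphereHomeomorph (θ : F ≃ₗᵢ[ℝ] F) : sphere (0 : F) 1 ≃ₜ sphere (0 : F) 1 :=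
  θ.toHomeomorph.subtype fun x => by simp

@[simp]
theorem coe_sphereHomeomorph (θ : F ≃ₗᵢ[ℝ] F) (v : sphere (0 : F) 1) :
    (sphereHomeomorph θ v : F) = θ v :=
  rfl

theorem measurePreserving_sphereHomeomorph [MeasurableSpace F] [BorelSpace F] {θ : F ≃ₗᵢ[ℝ] F}
    {μ : Measure F} (hθ : MeasurePreserving θ μ μ) :
    MeasurePreserving (sphereHomeomorph θ) μ.toSphere μ.toSphere := by
  refine ⟨(sphereHomeomorph θ).measurable, Measure.ext fun s hs => ?_⟩
  have himage : θ '' (Subtype.val '' (sphereHomeomorph θ ⁻¹' s)) = Subtype.val '' s := by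
    rw [Set.image_comm fun v => (coe_sphereHomeomorph θ v).symm,
      (sphereHomeomorph θ).image_preimage]
  have hpre : Set.Ioo (0 : ℝ) 1 • (Subtype.val '' (sphereHomeomorph θ ⁻¹' s) : Set F) =
      θ ⁻¹' (Set.Ioo (0 : ℝ) 1 • (Subtype.val '' s)) := by
    rw [← himage, ← Set.image2_smul, ← Set.image2_smul,
      ← Set.image_image2_distrib_right fun t x => map_smul θ t x,
      Set.preimage_image_eq _ θ.injective]
  rw [Measure.map_apply (sphereHomeomorph θ).measurable hs, Measure.toSphere_apply' _ hs,
    Measure.toSphere_apply' _ ((sphereHomeomorph θ).measurable hs), hpre,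
    hθ.measure_preimage_emb θ.toHomeomorph.measurableEmbedding]

end UnitSphere

section Reflections

variable {n : ℕ}

/-- The reflection `R_u` as a linear isometric equivalence. -/
def reflectIso (u : sphere (0 : E n) 1) : E n ≃ₗᵢ[ℝ] E n :=
  (ℝ ∙ (u : E n))ᗮ.reflection

@[simp]
theorem coe_reflectIso (u : sphere (0 : E n) 1) : ⇑(reflectIso u) = reflect u := by
  funext x
  rw [reflectIso, Submodule.reflection_orthogonal_apply, Submodule.reflection_singleton_apply,
    norm_eq_of_mem_sphere, real_inner_comm, reflect]
  simp [two_mul, two_smul, add_smul]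

@[simp]
theorem symm_reflectIso (u : sphere (0 : E n) 1) : (reflectIso u).symm = reflectIso u :=
  Submodule.reflection_symm

theorem exists_reflect_eq {x y : E n} (h : ‖x‖ = ‖y‖) (hne : x ≠ y) :
    ∃ u : sphere (0 : E n) 1, reflect u x = y := by
  have hxy : ‖x - y‖ ≠ 0 := norm_ne_zero_iff.2 (sub_ne_zero.2 hne)
  refine ⟨⟨‖x - y‖⁻¹ • (x - y), by simp [norm_smul, hxy]⟩, ?_⟩
  simp only [← coe_reflectIso, reflectIso,
    Submodule.span_singleton_smul_eq (IsUnit.mk0 _ (inv_ne_zero hxy))]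
  exact Submodule.reflection_sub h

theorem continuous_reflect :
    Continuous fun p : sphere (0 : E n) 1 × E n => reflect p.1 p.2 := by
  unfold reflect
  fun_prop

theorem isUniformlyTransitive_reflect {u : ℕ → sphere (0 : E n) 1} (hu : IsSyndeticallyDense u) :
    IsUniformlyTransitive fun m => sphereHomeomorph (reflectIso (u m)) := by
  intro δ hδ
  have hopen : IsOpen {q : sphere (0 : E n) 1 × sphere (0 : E n) 1 × sphere (0 : E n) 1 |
      dist (reflect q.1 q.2.1) q.2.2 < δ} :=
    isOpen_lt ((continuous_reflect.comp (by fun_prop :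
      Continuous fun q : sphere (0 : E n) 1 × sphere (0 : E n) 1 × sphere (0 : E n) 1 =>
        (q.1, (q.2.1 : E n)))).dist (by fun_prop)) continuous_const
  have hfar : IsCompact {p : sphere (0 : E n) 1 × sphere (0 : E n) 1 | δ ≤ dist p.1 p.2} :=
    (isClosed_le continuous_const continuous_dist).isCompact
  obtain ⟨W, hW⟩ := hu.exists_window hopen hfar fun ⟨x, y⟩ hxy => by
    have hne : (x : E n) ≠ y :=
      Subtype.coe_injective.ne (dist_pos.1 (hδ.trans_le hxy))
    obtain ⟨e, he⟩ := exists_reflect_eq (by simp) hne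
    exact ⟨e, by simpa [he] using hδ⟩
  refine ⟨W, fun m x y => or_iff_not_imp_left.2 fun hxy => ?_⟩
  simpa [Subtype.dist_eq] using hW m (x, y) (not_lt.1 hxy)

end Reflections

section SupportFunction

variable {n : ℕ} {K L : Set (E n)} {R : ℝ≥0}

theorem bddAbove_inner_image (hK : IsCompact K) (v : E n) :
    BddAbove ((fun x : E n => inner ℝ x v) '' K) :=
  (hK.image (by fun_prop)).bddAbove

theorem inner_le_supportFn (hK : IsCompact K) {x : E n} (hx : x ∈ K) (v : E n) :
    inner ℝ x v ≤ supportFn K v :=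
  le_csSup (bddAbove_inner_image hK v) (Set.mem_image_of_mem _ hx)

theorem exists_inner_eq_supportFn (hK : IsCompact K) (hne : K.Nonempty) (v : E n) :
    ∃ x ∈ K, inner ℝ x v = supportFn K v :=
  (hK.image (f := fun x : E n => inner ℝ x v) (by fun_prop)).sSup_mem (hne.image _)

theorem supportFn_add (hK : IsCompact K) (hKne : K.Nonempty) (hL : IsCompact L)
    (hLne : L.Nonempty) (v : E n) : supportFn (K + L) v = supportFn K v + supportFn L v := by
  rw [supportFn, ← Set.image2_add, Set.image_image2_distrib fun x y => inner_add_left x y v,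
    Set.image2_add, csSup_add (hKne.image _) (bddAbove_inner_image hK v) (hLne.image _)
      (bddAbove_inner_image hL v)]
  rfl

theorem supportFn_smul {c : ℝ} (hc : 0 ≤ c) (K : Set (E n)) (v : E n) :
    supportFn (c • K) v = c * supportFn K v := by
  rw [supportFn, Set.image_smul_comm _ _ _ fun x => real_inner_smul_left x v c,
    Real.sSup_smul_of_nonneg hc, smul_eq_mul, supportFn]

theorem supportFn_image (θ : E n ≃ₗᵢ[ℝ] E n) (K : Set (E n)) (v : E n) :
    supportFn (θ '' K) v = supportFn K (θ.symm v) := by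
  simp only [supportFn, Set.image_image, θ.inner_map_eq_flip]

theorem supportFn_zero (hne : K.Nonempty) : supportFn K 0 = 0 := by
  simp [supportFn, hne.image_const]

theorem lipschitzWith_supportFn (hK : IsCompact K) (hne : K.Nonempty) (hR : K ⊆ closedBall 0 R) :
    LipschitzWith R (supportFn K) := by
  refine LipschitzWith.of_le_add_mul R fun v w => ?_
  obtain ⟨x, hx, hxv⟩ := exists_inner_eq_supportFn hK hne v
  have hxR : ‖x‖ ≤ R := mem_closedBall_zero_iff.1 (hR hx)
  calc supportFn K v = inner ℝ x w + inner ℝ x (v - w) := by rw [← inner_add_right]; simp [hxv]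
    _ ≤ supportFn K w + ‖x‖ * ‖v - w‖ :=
      add_le_add (inner_le_supportFn hK hx w) (real_inner_le_norm _ _)
    _ ≤ supportFn K w + R * dist v w := by rw [dist_eq_norm]; gcongr

theorem abs_supportFn_le (hK : IsCompact K) (hne : K.Nonempty) (hR : K ⊆ closedBall 0 R)
    (v : E n) : |supportFn K v| ≤ R * ‖v‖ := by
  simpa [supportFn_zero hne] using (lipschitzWith_supportFn hK hne hR).dist_le_mul v 0

theorem continuous_supportFn (hK : IsCompact K) (hne : K.Nonempty) :
    Continuous (supportFn K) := by
  obtain ⟨R, hR, hKR⟩ := hK.isBounded.subset_closedBall_lt 0 0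
  exact (lipschitzWith_supportFn (R := ⟨R, hR.le⟩) hK hne hKR).continuous

theorem supportFn_add_supportFn_neg_nonneg (hK : IsCompact K) (hne : K.Nonempty) (v : E n) :
    0 ≤ supportFn K v + supportFn K (-v) := by
  obtain ⟨x, hx⟩ := hne
  have hneg := inner_le_supportFn hK hx (-v)
  rw [inner_neg_right] at hneg
  linarith [inner_le_supportFn hK hx v]

theorem supportFn_closedBall {r : ℝ} (hr : 0 ≤ r) (v : E n) :
    supportFn (closedBall 0 r) v = r * ‖v‖ := by
  have hball := isCompact_closedBall (0 : E n) r
  refine le_antisymm ((le_abs_self _).trans ?_) ?_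
  · exact abs_supportFn_le (R := ⟨r, hr⟩) hball (nonempty_closedBall.2 hr) subset_rfl v
  rcases eq_or_ne v 0 with rfl | hv
  · simp [supportFn_zero (nonempty_closedBall.2 hr)]
  have hmem : (r / ‖v‖) • v ∈ closedBall (0 : E n) r := by
    simp [norm_smul, abs_of_nonneg hr, hv]
  calc r * ‖v‖ = inner ℝ ((r / ‖v‖) • v) v := by
        rw [real_inner_smul_left, real_inner_self_eq_norm_sq]; field
    _ ≤ supportFn (closedBall 0 r) v := inner_le_supportFn hball hmem v

/-- The direction is the outer normal at the point of `L` nearest to `x`. -/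
theorem exists_infDist_le_inner_sub_supportFn (hL : IsCompact L) (hconv : Convex ℝ L)
    (hne : L.Nonempty) {x : E n} (hx : x ∉ L) :
    ∃ v : sphere (0 : E n) 1, infDist x L ≤ inner ℝ x (v : E n) - supportFn L v := by
  obtain ⟨p, hp, hmin⟩ := exists_norm_eq_iInf_of_complete_convex hne hL.isComplete hconv x
  rw [norm_eq_iInf_iff_real_inner_le_zero hconv hp] at hmin
  have hxp : ‖x - p‖ ≠ 0 := norm_ne_zero_iff.2 (sub_ne_zero.2 (ne_of_mem_of_not_mem hp hx).symm)
  refine ⟨⟨‖x - p‖⁻¹ • (x - p), by simp [norm_smul, hxp]⟩, ?_⟩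
  obtain ⟨y, hy, hyv⟩ := exists_inner_eq_supportFn hL hne (‖x - p‖⁻¹ • (x - p))
  calc infDist x L ≤ ‖x - p‖ := dist_eq_norm x p ▸ infDist_le_dist_of_mem hp
    _ = ‖x - p‖⁻¹ * inner ℝ (x - p) (x - p) := by rw [real_inner_self_eq_norm_sq]; field
    _ ≤ ‖x - p‖⁻¹ * (inner ℝ (x - p) (x - p) - inner ℝ (x - p) (y - p)) := by
      gcongr
      linarith [hmin y hy]
    _ = inner ℝ x (‖x - p‖⁻¹ • (x - p)) - inner ℝ y (‖x - p‖⁻¹ • (x - p)) := by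
      rw [← inner_sub_left, ← inner_sub_right, real_inner_smul_right, real_inner_comm]
      simp
    _ = inner ℝ x (‖x - p‖⁻¹ • (x - p)) - supportFn L (‖x - p‖⁻¹ • (x - p)) := by rw [hyv]

end SupportFunction

section MinkowskiSymmetral

variable {n : ℕ} {K L : Set (E n)}

theorem convexIndicator_of_mem {x : E n} (h : x ∈ K) : convexIndicator K x = 0 :=
  if_pos h

theorem convexIndicator_of_notMem {x : E n} (h : x ∉ K) : convexIndicator K x = ⊤ :=
  if_neg h

theorem convexIndicator_nonneg (K : Set (E n)) (x : E n) : 0 ≤ convexIndicator K x := by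
  unfold convexIndicator
  split_ifs <;> simp

theorem convexIndicator_lt_top_iff {x : E n} : convexIndicator K x < ⊤ ↔ x ∈ K := by
  unfold convexIndicator
  split_ifs with h <;> simp [h]

theorem convexIndicator_le_coe_iff {x : E n} {r : ℝ} :
    convexIndicator K x ≤ r ↔ x ∈ K ∧ 0 ≤ r := by
  unfold convexIndicator
  split_ifs with h <;> simp [h]

theorem infConv_convexIndicator (K L : Set (E n)) :
    infConv (convexIndicator K) (convexIndicator L) = convexIndicator (K + L) := by
  funext x
  by_cases hx : x ∈ K + L
  · obtain ⟨y, hy, z, hz, rfl⟩ := hx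
    rw [convexIndicator_of_mem (Set.add_mem_add hy hz)]
    refine le_antisymm (iInf_le_of_le y ?_)
      (le_iInf fun _ => add_nonneg (convexIndicator_nonneg _ _) (convexIndicator_nonneg _ _))
    simp [convexIndicator_of_mem hy, convexIndicator_of_mem hz]
  · rw [convexIndicator_of_notMem hx, infConv, iInf_eq_top]
    intro y
    by_cases hy : y ∈ K
    · have hz : x - y ∉ L := fun hz => hx ⟨y, hy, x - y, hz, add_sub_cancel y x⟩
      rw [convexIndicator_of_mem hy, convexIndicator_of_notMem hz, zero_add]
    · rw [convexIndicator_of_notMem hy, EReal.top_add_of_ne_bot]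
      exact (EReal.bot_lt_zero.trans_le (convexIndicator_nonneg L _)).ne'

theorem epiMul_convexIndicator {c : ℝ} (hc : 0 < c) (K : Set (E n)) :
    epiMul c (convexIndicator K) = convexIndicator (c • K) := by
  funext x
  by_cases hx : c⁻¹ • x ∈ K
  · rw [epiMul, convexIndicator_of_mem hx, mul_zero,
      convexIndicator_of_mem ((Set.mem_smul_set_iff_inv_smul_mem₀ hc.ne' _ _).2 hx)]
  · rw [epiMul, convexIndicator_of_notMem hx, EReal.coe_mul_top_of_pos hc,
      convexIndicator_of_notMem (mt (Set.mem_smul_set_iff_inv_smul_mem₀ hc.ne' _ _).1 hx)]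

/-- The Minkowski symmetral `(K + R_u K) / 2` of a set, the counterpart of `minkSym` for convex
indicators. -/
def minkSymSet (u : sphere (0 : E n) 1) (K : Set (E n)) : Set (E n) :=
  (1 / 2 : ℝ) • K + (1 / 2 : ℝ) • (reflectIso u '' K)

/-- Successive Minkowski symmetrals of a set, indexed as in `minkSymIter`. -/
def minkSymSetIter (u : ℕ → sphere (0 : E n) 1) (K : Set (E n)) : ℕ → Set (E n)
  | 0 => K
  | m + 1 => minkSymSet (u m) (minkSymSetIter u K m)

theorem minkSym_convexIndicator (u : sphere (0 : E n) 1) (K : Set (E n)) :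
    minkSym u (convexIndicator K) = convexIndicator (minkSymSet u K) := by
  have hreflect : (fun x => convexIndicator K (reflect u x)) =
      convexIndicator (reflectIso u '' K) := by
    rw [LinearIsometryEquiv.image_eq_preimage_symm, symm_reflectIso, coe_reflectIso]
    rfl
  rw [minkSym, hreflect, epiMul_convexIndicator one_half_pos, epiMul_convexIndicator one_half_pos,
    infConv_convexIndicator, minkSymSet]

theorem minkSymIter_convexIndicator (u : ℕ → sphere (0 : E n) 1) (K : Set (E n)) :
    minkSymIter u (convexIndicator K) = fun m => convexIndicator (minkSymSetIter u K m) := by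
  funext m
  induction m with
  | zero => rfl
  | succ m ih => rw [minkSymIter, ih, minkSym_convexIndicator, minkSymSetIter]

theorem isCompact_minkSymSet (u : sphere (0 : E n) 1) (hK : IsCompact K) :
    IsCompact (minkSymSet u K) :=
  (hK.smul _).add ((hK.image (reflectIso u).continuous).smul _)

theorem convex_minkSymSet (u : sphere (0 : E n) 1) (hK : Convex ℝ K) :
    Convex ℝ (minkSymSet u K) :=
  (hK.smul _).add ((hK.is_linear_image (reflectIso u).toLinearEquiv.isLinear).smul _)

theorem nonempty_minkSymSet (u : sphere (0 : E n) 1) (hK : K.Nonempty) :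
    (minkSymSet u K).Nonempty :=
  hK.smul_set.add (hK.image _).smul_set

theorem minkSymSet_subset_closedBall (u : sphere (0 : E n) 1) {R : ℝ} (hK : K ⊆ closedBall 0 R) :
    minkSymSet u K ⊆ closedBall 0 R := by
  have himage : reflectIso u '' K ⊆ closedBall 0 R := by
    rw [← map_zero (reflectIso u), ← LinearIsometryEquiv.image_closedBall]
    exact Set.image_mono hK
  calc minkSymSet u K ⊆ (1 / 2 : ℝ) • closedBall 0 R + (1 / 2 : ℝ) • closedBall 0 R :=
        Set.add_subset_add (Set.smul_set_mono hK) (Set.smul_set_mono himage)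
    _ ⊆ closedBall 0 R :=
        (convex_iff_pointwise_add_subset.1 (convex_closedBall 0 R)) one_half_pos.le
          one_half_pos.le (add_halves 1)

theorem supportFn_minkSymSet (u : sphere (0 : E n) 1) (hK : IsCompact K) (hne : K.Nonempty)
    (v : E n) : supportFn (minkSymSet u K) v = (supportFn K v + supportFn K (reflect u v)) / 2 := by
  have hKu := hK.image (reflectIso u).continuous
  rw [minkSymSet, supportFn_add (hK.smul _) hne.smul_set (hKu.smul _) (hne.image _).smul_set,
    supportFn_smul one_half_pos.le, supportFn_smul one_half_pos.le, supportFn_image,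
    symm_reflectIso, coe_reflectIso]
  ring

section Iter

variable (u : ℕ → sphere (0 : E n) 1)

theorem minkSymSetIter_induction {P : Set (E n) → Prop} (h0 : P K)
    (hstep : ∀ e L, P L → P (minkSymSet e L)) (m : ℕ) : P (minkSymSetIter u K m) := by
  induction m with
  | zero => exact h0
  | succ m ih => exact hstep _ _ ih

theorem isCompact_minkSymSetIter (hK : IsCompact K) : ∀ m, IsCompact (minkSymSetIter u K m) :=
  minkSymSetIter_induction u hK fun e _ => isCompact_minkSymSet e

theorem convex_minkSymSetIter (hK : Convex ℝ K) : ∀ m, Convex ℝ (minkSymSetIter u K m) :=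
  minkSymSetIter_induction u hK fun e _ => convex_minkSymSet e

theorem nonempty_minkSymSetIter (hK : K.Nonempty) : ∀ m, (minkSymSetIter u K m).Nonempty :=
  minkSymSetIter_induction u hK fun e _ => nonempty_minkSymSet e

theorem minkSymSetIter_subset_closedBall {R : ℝ} (hK : K ⊆ closedBall 0 R) :
    ∀ m, minkSymSetIter u K m ⊆ closedBall 0 R :=
  minkSymSetIter_induction (P := (· ⊆ closedBall 0 R)) u hK fun e _ =>
    minkSymSet_subset_closedBall e

theorem isAveraging_supportFn_minkSymSetIter (hK : IsCompact K) (hne : K.Nonempty) :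
    IsAveraging (fun m => sphereHomeomorph (reflectIso (u m)))
      fun m (v : sphere (0 : E n) 1) => supportFn (minkSymSetIter u K m) v := by
  intro m v
  simpa [minkSymSetIter] using supportFn_minkSymSet (u m) (isCompact_minkSymSetIter u hK m)
    (nonempty_minkSymSetIter u hne m) (v : E n)

end Iter

end MinkowskiSymmetral

section MeanWidth

variable {n : ℕ} {K : Set (E n)}

theorem integrable_supportFn (hK : IsCompact K) (hne : K.Nonempty) :
    Integrable (fun v : sphere (0 : E n) 1 => supportFn K v) (volume : Measure (E n)).toSphere :=
  ((continuous_supportFn hK hne).comp continuous_subtype_val).integrable_of_hasCompactSupport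
    (HasCompactSupport.of_compactSpace _)

theorem meanWidth_minkSymSet (u : sphere (0 : E n) 1) (hK : IsCompact K) (hne : K.Nonempty) :
    meanWidth (minkSymSet u K) = meanWidth K := by
  have hmp := measurePreserving_sphereHomeomorph (reflectIso u).measurePreserving
  have hint := integrable_supportFn hK hne
  have hint' := hmp.integrable_comp_of_integrable hint
  have hcomp := hmp.integral_comp (sphereHomeomorph (reflectIso u)).measurableEmbedding
    fun v : sphere (0 : E n) 1 => supportFn K v
  simp only [Function.comp_def, coe_sphereHomeomorph, coe_reflectIso] at hint' hcomp
  simp only [meanWidth, average_eq, supportFn_minkSymSet u hK hne]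
  rw [integral_div, integral_add hint hint', hcomp, add_self_div_two]

theorem meanWidth_minkSymSetIter (u : ℕ → sphere (0 : E n) 1) (hK : IsCompact K)
    (hne : K.Nonempty) (m : ℕ) : meanWidth (minkSymSetIter u K m) = meanWidth K := by
  induction m with
  | zero => rfl
  | succ m ih =>
    rw [minkSymSetIter, meanWidth_minkSymSet _ (isCompact_minkSymSetIter u hK m)
      (nonempty_minkSymSetIter u hne m), ih]

theorem meanWidth_closedBall [NeZero n] {r : ℝ} (hr : 0 ≤ r) :
    meanWidth (closedBall (0 : E n) r) = 2 * r := by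
  have : NeZero (volume : Measure (E n)).toSphere := ⟨Measure.toSphere_ne_zero _⟩
  simp [meanWidth, supportFn_closedBall hr]

theorem meanWidthBall_eq_closedBall [NeZero n] (K : Set (E n)) :
    meanWidthBall K = closedBall 0 ‖meanWidth K / 2‖ := by
  rw [← smul_unitClosedBall]
  ext y
  simp [meanWidthBall, meanWidth_closedBall zero_le_one, Set.mem_smul_set, eq_comm]

theorem tendsto_meanWidth {L : ℕ → Set (E n)} {C : Set (E n)} (hL : ∀ j, IsCompact (L j))
    (hne : ∀ j, (L j).Nonempty) {R : ℝ≥0} (hR : ∀ j, L j ⊆ closedBall 0 R)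
    (hlim : ∀ v : sphere (0 : E n) 1,
      Tendsto (fun j => supportFn (L j) v) atTop (𝓝 (supportFn C v))) :
    Tendsto (fun j => meanWidth (L j)) atTop (𝓝 (meanWidth C)) := by
  simp only [meanWidth, average_eq]
  refine ((tendsto_integral_of_dominated_convergence (fun _ => (R : ℝ))
    (fun j => (integrable_supportFn (hL j) (hne j)).aestronglyMeasurable)
    (integrable_const _) (fun j => ?_) (.of_forall hlim)).const_smul _).const_mul 2
  exact .of_forall fun v => by simpa using abs_supportFn_le (hL j) (hne j) (hR j) (v : E n)

end MeanWidth

section EpiConvergence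

variable {n : ℕ} {L : ℕ → Set (E n)} {C : Set (E n)}

theorem EpiConverges.comp {Ψ : ℕ → E n → EReal} {ψ : E n → EReal} (h : EpiConverges Ψ ψ)
    {l : ℕ → ℕ} (hl : StrictMono l) : EpiConverges (fun j => Ψ (l j)) ψ := by
  refine fun x => ⟨fun xs hxs => ?_, ?_⟩
  · set z : ℕ → E n := Function.extend l xs fun _ => x
    have hzl : ∀ j, z (l j) = xs j := hl.injective.extend_apply xs _
    have hz : Tendsto z atTop (𝓝 x) := by
      rw [← Nat.cofinite_eq_atTop] at hxs ⊢
      refine fun U hU => ((hxs hU).image l).subset fun k hk => ?_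
      by_cases hkl : ∃ j, l j = k
      · obtain ⟨j, rfl⟩ := hkl
        exact ⟨j, by simpa [hzl] using hk, rfl⟩
      · have hzk : z k = x := Function.extend_apply' xs _ k hkl
        exact absurd (mem_of_mem_nhds hU) (hzk ▸ hk)
    calc ψ x ≤ liminf (fun k => Ψ k (z k)) atTop := (h x).1 z hz
      _ ≤ liminf (fun k => Ψ k (z k)) (map l atTop) := liminf_le_liminf_of_le hl.tendsto_atTop
      _ = liminf (fun j => Ψ (l j) (xs j)) atTop := by
        rw [← liminf_comp]
        simp only [Function.comp_def, hzl]
  · obtain ⟨xs, hxs, hlim⟩ := (h x).2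
    exact ⟨xs ∘ l, hxs.comp hl.tendsto_atTop, hlim.comp hl.tendsto_atTop⟩

theorem EpiConverges.eq_zero_or_eq_top {φ : E n → EReal}
    (h : EpiConverges (fun j => convexIndicator (L j)) φ) (x : E n) : φ x = 0 ∨ φ x = ⊤ := by
  obtain ⟨xs, -, hlim⟩ := (h x).2
  refine (Set.toFinite {0, ⊤}).isClosed.mem_of_tendsto hlim (.of_forall fun j => ?_)
  simp only [convexIndicator]
  split_ifs <;> simp

/-- Epi-convergence of indicators is Painlevé–Kuratowski convergence of sets. -/
theorem epiConverges_convexIndicator_iff :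
    EpiConverges (fun j => convexIndicator (L j)) (convexIndicator C) ↔
      (∀ x ∈ C, ∃ xs : ℕ → E n, Tendsto xs atTop (𝓝 x) ∧ ∀ᶠ j in atTop, xs j ∈ L j) ∧
      ∀ x ∉ C, ∀ xs : ℕ → E n, Tendsto xs atTop (𝓝 x) → ∀ᶠ j in atTop, xs j ∉ L j := by
  constructor
  · refine fun h => ⟨fun x hx => ?_, fun x hx xs hxs => ?_⟩
    · obtain ⟨xs, hxs, hlim⟩ := (h x).2
      refine ⟨xs, hxs, (hlim.eventually_lt_const ?_).mono fun j => convexIndicator_lt_top_iff.1⟩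
      exact convexIndicator_lt_top_iff.2 hx
    · have hliminf := (h x).1 xs hxs
      rw [convexIndicator_of_notMem hx] at hliminf
      refine (eventually_lt_of_lt_liminf (EReal.zero_lt_top.trans_le hliminf)).mono fun j hj hmem =>
        hj.ne' (convexIndicator_of_mem hmem)
  · rintro ⟨hin, hout⟩ x
    by_cases hx : x ∈ C
    · obtain ⟨xs, hxs, hmem⟩ := hin x hx
      rw [convexIndicator_of_mem hx]
      exact ⟨fun _ _ => le_liminf_of_le (by isBoundedDefault)
        (.of_forall fun j => convexIndicator_nonneg _ _), xs, hxs,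
        tendsto_const_nhds.congr' (hmem.mono fun j hj => (convexIndicator_of_mem hj).symm)⟩
    · have htop : ∀ xs : ℕ → E n, Tendsto xs atTop (𝓝 x) →
          Tendsto (fun j => convexIndicator (L j) (xs j)) atTop (𝓝 ⊤) := fun xs hxs =>
        tendsto_const_nhds.congr' <|
          (hout x hx xs hxs).mono fun j hj => (convexIndicator_of_notMem hj).symm
      rw [convexIndicator_of_notMem hx]
      exact ⟨fun xs hxs => (htop xs hxs).liminf_eq.ge, fun _ => x, tendsto_const_nhds,
        htop _ tendsto_const_nhds⟩

theorem EpiConverges.tendsto_supportFn (hC : IsCompact C) (hCne : C.Nonempty)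
    (h : EpiConverges (fun j => convexIndicator (L j)) (convexIndicator C))
    (hL : ∀ j, IsCompact (L j)) (hne : ∀ j, (L j).Nonempty) {R : ℝ}
    (hR : ∀ j, L j ⊆ closedBall 0 R) (v : E n) :
    Tendsto (fun j => supportFn (L j) v) atTop (𝓝 (supportFn C v)) := by
  refine tendsto_order.2 ⟨fun a ha => ?_, fun a ha => ?_⟩
  · obtain ⟨x, hx, hxv⟩ := exists_inner_eq_supportFn hC hCne v
    obtain ⟨xs, hxs, hmem⟩ := (epiConverges_convexIndicator_iff.1 h).1 x hx
    have hinner : Tendsto (fun j => inner ℝ (xs j) v) atTop (𝓝 (supportFn C v)) :=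
      hxv ▸ hxs.inner tendsto_const_nhds
    filter_upwards [hmem, hinner.eventually_const_lt ha] with j hj haj
    exact haj.trans_le (inner_le_supportFn (hL j) hj v)
  · by_contra hfreq
    obtain ⟨l, hl, hla⟩ := extraction_of_frequently_atTop (not_eventually.1 hfreq)
    choose x hx hxv using fun j => exists_inner_eq_supportFn (hL j) (hne j) v
    obtain ⟨y, -, l', hl', hy⟩ :=
      tendsto_subseq_of_bounded isBounded_closedBall fun j => hR (l j) (hx (l j))
    have hyC : y ∈ C := by
      by_contra hyC
      have hout := (epiConverges_convexIndicator_iff.1 (h.comp (hl.comp hl'))).2 y hyC _ hy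
      obtain ⟨j, hj⟩ := hout.exists
      exact hj (hx _)
    have hay : a ≤ inner ℝ y v := ge_of_tendsto (hy.inner tendsto_const_nhds) <|
      .of_forall fun j => by simpa [hxv] using hla (l' j)
    exact ha.not_ge (hay.trans (inner_le_supportFn hC hyC v))

theorem epiConverges_of_tendstoUniformly_supportFn (hL : ∀ j, IsCompact (L j))
    (hLconv : ∀ j, Convex ℝ (L j)) (hLne : ∀ j, (L j).Nonempty) (hC : IsCompact C)
    (hCconv : Convex ℝ C) (hCne : C.Nonempty)
    (h : TendstoUniformly (fun j (v : sphere (0 : E n) 1) => supportFn (L j) v)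
      (fun v => supportFn C v) atTop) :
    EpiConverges (fun j => convexIndicator (L j)) (convexIndicator C) := by
  refine epiConverges_convexIndicator_iff.2 ⟨fun x hx => ?_, fun x hx xs hxs => ?_⟩
  · choose p hp hdist using fun j => (hL j).exists_infDist_eq_dist (hLne j) x
    refine ⟨p, Metric.tendsto_nhds.2 fun ε hε => ?_, .of_forall hp⟩
    filter_upwards [Metric.tendstoUniformly_iff.1 h ε hε] with j hj
    rw [dist_comm, ← hdist]
    by_cases hxL : x ∈ L j
    · rwa [infDist_zero_of_mem hxL]
    obtain ⟨v, hv⟩ := exists_infDist_le_inner_sub_supportFn (hL j) (hLconv j) (hLne j) hxL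
    calc infDist x (L j) ≤ inner ℝ x (v : E n) - supportFn (L j) v := hv
      _ ≤ supportFn C v - supportFn (L j) v := by gcongr; exact inner_le_supportFn hC hx v
      _ < ε := (le_abs_self _).trans_lt (hj v)
  · obtain ⟨v, hv⟩ := exists_infDist_le_inner_sub_supportFn hC hCconv hCne hx
    have hlt : supportFn C v < inner ℝ x (v : E n) :=
      sub_pos.1 (((hC.isClosed.notMem_iff_infDist_pos hCne).1 hx).trans_le hv)
    have hinner : Tendsto (fun j => inner ℝ (xs j) (v : E n)) atTop (𝓝 (inner ℝ x (v : E n))) :=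
      hxs.inner tendsto_const_nhds
    filter_upwards [(h.tendsto_at v).eventually_lt hinner hlt] with j hj hmem
    exact hj.not_ge (inner_le_supportFn (hL j) hmem v)

end EpiConvergence

section Balls

theorem exists_eq_closedBall_of_isometry_invariant {F : Type*} [NormedAddCommGroup F]
    [InnerProductSpace ℝ F] [Nontrivial F] {C : Set F} (hC : IsCompact C) (hconv : Convex ℝ C)
    (hne : C.Nonempty) (hinv : ∀ θ : F ≃ₗᵢ[ℝ] F, ∀ x ∈ C, θ x ∈ C) :
    ∃ r ≥ 0, C = closedBall 0 r := by
  obtain ⟨x, hx, hmax⟩ := hC.exists_isMaxOn hne continuous_norm.continuousOn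
  refine ⟨‖x‖, norm_nonneg x, subset_antisymm (fun y hy => by simpa using hmax hy) ?_⟩
  rw [← convexHull_sphere_eq_closedBall (0 : F) (norm_nonneg x)]
  refine convexHull_min (fun y hy => ?_) hconv
  have hxy : ‖x‖ = ‖y‖ := (mem_sphere_zero_iff_norm.1 hy).symm
  rw [← Submodule.reflection_sub hxy]
  exact hinv _ x hx

variable {n : ℕ} {φ : E n → EReal}

theorem IsConvC.isCompact_sublevel (h : IsConvC φ) (a : ℝ) : IsCompact {x | φ x ≤ a} := by
  refine isCompact_of_isClosed_isBounded (h.lsc.isClosed_preimage a) ?_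
  rw [Bornology.isBounded_def]
  filter_upwards [h.coercive.eventually_const_lt (EReal.coe_lt_top a)] with x hx
  exact hx.not_ge

theorem IsConvC.convex_sublevel (h : IsConvC φ) (a : ℝ) : Convex ℝ {x | φ x ≤ a} := by
  intro x hx y hy s t hs ht hst
  have hmem := h.convex (x := (x, a)) hx (y := (y, a)) hy hs ht hst
  simpa [← add_mul, hst] using hmem

theorem isConvC_convexIndicator {C : Set (E n)} (hC : IsCompact C) (hconv : Convex ℝ C)
    (hne : C.Nonempty) : IsConvC (convexIndicator C) where
  convex := by
    simp only [convexIndicator_le_coe_iff]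
    rintro ⟨x, s⟩ ⟨hx, hs⟩ ⟨y, t⟩ ⟨hy, ht⟩ a b ha hb hab
    exact ⟨hconv hx hy ha hb hab, add_nonneg (mul_nonneg ha hs) (mul_nonneg hb ht)⟩
  coercive := tendsto_const_nhds.congr' <| by
    filter_upwards [Bornology.isBounded_def.1 hC.isBounded] with x hx
    exact (convexIndicator_of_notMem hx).symm
  dom_nonempty := hne.imp fun _ => convexIndicator_lt_top_iff.2
  ne_bot x := (EReal.bot_lt_zero.trans_le (convexIndicator_nonneg C x)).ne'
  lsc := by
    intro x a ha
    by_cases hx : x ∈ C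
    · rw [convexIndicator_of_mem hx] at ha
      exact .of_forall fun y => ha.trans_le (convexIndicator_nonneg C y)
    · filter_upwards [hC.isClosed.isOpen_compl.mem_nhds hx] with y hy
      rwa [convexIndicator_of_notMem hy, ← convexIndicator_of_notMem hx]

theorem rotationInvariant_convexIndicator_closedBall (r : ℝ) :
    RotationInvariant (convexIndicator (closedBall (0 : E n) r)) := fun θ x => by
  simp [convexIndicator]

end Balls

section Symmetrization

variable {n : ℕ} {K : Set (E n)}

theorem base_charFn (α : ℝ) (K : Set (E n)) : base α (charFn K) = convexIndicator K := by
  funext x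
  by_cases hx : x ∈ K <;> simp [base, charFn, convexIndicator, hx]

theorem ofBase_convexIndicator (α : ℝ) (K : Set (E n)) :
    ofBase α (convexIndicator K) = charFn K := by
  funext x
  by_cases hx : x ∈ K <;> simp [ofBase, charFn, convexIndicator, hx]

variable [NeZero n]

theorem EpiConverges.meanWidthBall_eq {u : ℕ → sphere (0 : E n) 1} {k : ℕ → ℕ} {r : ℝ}
    (hr : 0 ≤ r) (hK : IsCompact K) (hne : K.Nonempty)
    (h : EpiConverges (fun j => minkSymIter u (convexIndicator K) (k j))
      (convexIndicator (closedBall 0 r))) : meanWidthBall K = closedBall 0 r := by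
  simp only [minkSymIter_convexIndicator] at h
  obtain ⟨R, hR, hKR⟩ := hK.isBounded.subset_closedBall_lt 0 0
  have hcpt j := isCompact_minkSymSetIter u hK (k j)
  have hne' j := nonempty_minkSymSetIter u hne (k j)
  have hball j := minkSymSetIter_subset_closedBall u hKR (k j)
  have hlim := tendsto_meanWidth (R := ⟨R, hR.le⟩) hcpt hne' hball fun v =>
    h.tendsto_supportFn (isCompact_closedBall 0 r) (nonempty_closedBall.2 hr) hcpt hne' hball v
  simp only [meanWidth_minkSymSetIter u hK hne] at hlim
  rw [meanWidthBall_eq_closedBall, tendsto_nhds_unique tendsto_const_nhds hlim,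
    meanWidth_closedBall hr, mul_div_cancel_left₀ r two_ne_zero, Real.norm_of_nonneg hr]

theorem exists_tendstoUniformly_supportFn {u : ℕ → sphere (0 : E n) 1}
    (hu : IsSyndeticallyDense u) (hK : IsCompact K) (hne : K.Nonempty) :
    ∃ r ≥ 0, TendstoUniformly
      (fun m (v : sphere (0 : E n) 1) => supportFn (minkSymSetIter u K m) v)
      (fun _ => r) atTop := by
  have : Nonempty (sphere (0 : E n) 1) := (NormedSpace.sphere_nonempty.2 zero_le_one).to_subtype
  obtain ⟨R, hR, hKR⟩ := hK.isBounded.subset_closedBall_lt 0 0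
  lift R to ℝ≥0 using hR.le
  have hcpt := isCompact_minkSymSetIter u hK
  have hne' := nonempty_minkSymSetIter u hne
  have hlip : ∀ m, LipschitzWith R
      fun v : sphere (0 : E n) 1 => supportFn (minkSymSetIter u K m) v := fun m => by
    simpa [Function.comp_def] using (lipschitzWith_supportFn (hcpt m) (hne' m)
      (minkSymSetIter_subset_closedBall u hKR m)).comp (LipschitzWith.subtype_val _)
  obtain ⟨r, hr⟩ := (isAveraging_supportFn_minkSymSetIter u hK hne).exists_tendstoUniformly_const
    (isUniformlyTransitive_reflect hu) (LipschitzWith.uniformEquicontinuous _ R hlip)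
    fun v => by simpa using abs_supportFn_le (hcpt 0) (hne' 0) hKR (v : E n)
  refine ⟨r, ?_, hr⟩
  obtain ⟨v⟩ := this
  have hwidth : 0 ≤ r + r := ge_of_tendsto ((hr.tendsto_at v).add (hr.tendsto_at (-v))) <|
    .of_forall fun m => supportFn_add_supportFn_neg_nonneg (hcpt m) (hne' m) (v : E n)
  linarith

theorem epiConverges_minkSymIter {u : ℕ → sphere (0 : E n) 1} (hu : IsSyndeticallyDense u)
    (hK : IsCompact K) (hconv : Convex ℝ K) (hne : K.Nonempty) :
    EpiConverges (minkSymIter u (convexIndicator K)) (convexIndicator (meanWidthBall K)) := by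
  obtain ⟨r, hr, hlim⟩ := exists_tendstoUniformly_supportFn hu hK hne
  have hepi : EpiConverges (minkSymIter u (convexIndicator K))
      (convexIndicator (closedBall 0 r)) := by
    rw [minkSymIter_convexIndicator]
    exact epiConverges_of_tendstoUniformly_supportFn (isCompact_minkSymSetIter u hK)
      (convex_minkSymSetIter u hconv) (nonempty_minkSymSetIter u hne) (isCompact_closedBall 0 r)
      (convex_closedBall 0 r) (nonempty_closedBall.2 hr) (by simpa [supportFn_closedBall hr])
  rwa [EpiConverges.meanWidthBall_eq (k := id) hr hK hne hepi]

theorem exists_epiConverges_minkSymIter (hK : IsCompact K) (hconv : Convex ℝ K)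
    (hne : K.Nonempty) : ∃ u : ℕ → sphere (0 : E n) 1,
      EpiConverges (minkSymIter u (convexIndicator K)) (convexIndicator (meanWidthBall K)) := by
  have : Nonempty (sphere (0 : E n) 1) := (NormedSpace.sphere_nonempty.2 zero_le_one).to_subtype
  obtain ⟨u, hu⟩ := exists_isSyndeticallyDense (X := sphere (0 : E n) 1)
  exact ⟨u, epiConverges_minkSymIter hu hK hconv hne⟩

theorem IsEpiSymmetrization.exists_eq_convexIndicator_closedBall {φ : E n → EReal}
    (h : IsEpiSymmetrization (convexIndicator K) φ) :
    ∃ r ≥ 0, φ = convexIndicator (closedBall 0 r) := by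
  obtain ⟨hφ, hrot, u, k, -, hepi⟩ := h
  simp only [minkSymIter_convexIndicator] at hepi
  have hval := hepi.eq_zero_or_eq_top
  have hne : {x | φ x ≤ (0 : ℝ)}.Nonempty :=
    hφ.dom_nonempty.imp fun x hx => ((hval x).resolve_right hx.ne).le
  obtain ⟨r, hr, hball⟩ := exists_eq_closedBall_of_isometry_invariant (hφ.isCompact_sublevel 0)
    (hφ.convex_sublevel 0) hne fun θ x hx => (hrot θ x).trans_le hx
  refine ⟨r, hr, funext fun x => ?_⟩
  rw [← hball]
  rcases hval x with hx | hx <;> simp [convexIndicator, hx]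

theorem isEpiSymmetrization_convexIndicator_iff (hK : IsCompact K) (hconv : Convex ℝ K)
    (hne : K.Nonempty) {φ : E n → EReal} :
    IsEpiSymmetrization (convexIndicator K) φ ↔ φ = convexIndicator (meanWidthBall K) := by
  constructor
  · intro h
    obtain ⟨r, hr, rfl⟩ := h.exists_eq_convexIndicator_closedBall
    obtain ⟨-, -, u, k, -, hepi⟩ := h
    rw [hepi.meanWidthBall_eq hr hK hne]
  · rintro rfl
    obtain ⟨u, hepi⟩ := exists_epiConverges_minkSymIter hK hconv hne
    rw [meanWidthBall_eq_closedBall] at hepi ⊢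
    exact ⟨isConvC_convexIndicator (isCompact_closedBall 0 _) (convex_closedBall 0 _)
      (nonempty_closedBall.2 (norm_nonneg _)), rotationInvariant_convexIndicator_closedBall _,
      u, id, strictMono_id, hepi⟩

end Symmetrization

end HypoSym

end

theorem lemma6p5_general (n : ℕ) (hn : 1 ≤ n) (K : Set (HypoSym.E n)) (hK : IsCompact K)
    (hconv : Convex ℝ K) (hne : K.Nonempty) :
    (∃ u : ℕ → Metric.sphere (0 : HypoSym.E n) 1,
      HypoSym.EpiConverges (HypoSym.minkSymIter u (HypoSym.convexIndicator K))
        (HypoSym.convexIndicator (HypoSym.meanWidthBall K))) ∧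
    (∀ φ : HypoSym.E n → EReal,
      HypoSym.IsEpiSymmetrization (HypoSym.convexIndicator K) φ ↔
        φ = HypoSym.convexIndicator (HypoSym.meanWidthBall K)) ∧
    (∀ (α : ℝ) (g : HypoSym.E n → ℝ),
      HypoSym.IsHypoSymmetrization α (HypoSym.charFn K) g ↔
        g = HypoSym.charFn (HypoSym.meanWidthBall K)) := by
  have : NeZero n := ⟨Nat.one_le_iff_ne_zero.1 hn⟩
  have hiff := fun φ => HypoSym.isEpiSymmetrization_convexIndicator_iff hK hconv hne (φ := φ)
  refine ⟨HypoSym.exists_epiConverges_minkSymIter hK hconv hne, hiff, fun α g => ?_⟩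
  simp only [HypoSym.IsHypoSymmetrization, HypoSym.base_charFn, hiff, exists_eq_left,
    HypoSym.ofBase_convexIndicator]

/-- For a convex body `K`, the ball indicator `I_{K_w^*}^∞` is the epi-limit of a full sequence of
successive Minkowski symmetrizations of `I_K^∞`; it is the one and only epi-symmetrization of
`I_K^∞`; and `1_{K_w^*}` is the one and only hypo-symmetrization of `1_K`, for every `α`. -/
theorem lemma6p5 (n : ℕ) (hn : 1 ≤ n) (K : Set (HypoSym.E n)) (hK : HypoSym.IsConvexBody K) :
    (∃ u : ℕ → Metric.sphere (0 : HypoSym.E n) 1,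
      HypoSym.EpiConverges (HypoSym.minkSymIter u (HypoSym.convexIndicator K))
        (HypoSym.convexIndicator (HypoSym.meanWidthBall K))) ∧
    (∀ φ : HypoSym.E n → EReal,
      HypoSym.IsEpiSymmetrization (HypoSym.convexIndicator K) φ ↔
        φ = HypoSym.convexIndicator (HypoSym.meanWidthBall K)) ∧
    (∀ (α : ℝ) (g : HypoSym.E n → ℝ),
      HypoSym.IsHypoSymmetrization α (HypoSym.charFn K) g ↔
        g = HypoSym.charFn (HypoSym.meanWidthBall K)) :=
  lemma6p5_general n hn K hK.compact hK.convex (hK.interior_nonempty.mono interior_subset)
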